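/- For $t\in\mathbb R$ let $\|t\|$ be the distance from $t$ to the nearest integer, and for $\theta=(\theta_1,\theta_2)\in\mathbb R^2$ put $$\mathrm{Bad}_\theta=\Big\{(\eta_1,\eta_2)\in\mathbb R^2:\ \inf_{x\in\mathbb N,\,x\ge 1} x^{1/2}\max_{i=1,2}\|x\theta_i-\eta_i\|>0\Big\}.$$ Schmidt's game in a Euclidean affine space $\mathcal A$ of positive dimension with parameters $\alpha,\beta\in(0,1)$: players B and A alternately choose closed balls of positive radius $B_1\supset A_1\supset B_2\supset A_2\supset\cdots$ in $\mathcal A$ with $\operatorname{diam}A_i=\alpha\operatorname{diam}B_i$ and $\operatorname{diam}B_{i+1}=\beta\operatorname{diam}A_i$. A set $E\subset\mathcal A$ is $\alpha$-winning in $\mathcal A$ if for every $\beta\in(0,1)$ player A has a strategy which guarantees that $\bigcap_i A_i$ meets $E$. A set $E\subset\mathbb R^n$ is isotropically winning if for every $1\le d\le n$ and every $d$-dimensional affine subspace $\mathcal A\subset\mathbb R^n$ the set $E\cap\mathcal A$ is $1/2$-winning in $\mathcal A$. **Theorem.** Let $\omega$ be a positive function on $(0,\infty)$, monotonically increasing (not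 necessarily strictly) to infinity. Then there exist a vector $\theta=(\theta_1,\theta_2)\in\mathbb R^2$ and an affine line $\mathcal P\subset\mathbb R^2$ through $\theta$ (both may depend on $\omega$) such that 1. $1,\theta_1,\theta_2$ are linearly independent over $\mathbb Z$; 2. $\mathrm{Bad}_\theta$ is not isotropically winning; 3. the segment $\mathcal D=\{\eta\in\mathcal P:|\eta-\theta|\le 1\}$ satisfies $\mathcal D\cap\mathrm{Bad}_\theta=\emptyset$; 4. for every $\eta\in\mathcal D$ the inequality $\max_{i=1,2}\|x\theta_i-\eta_i\|<\omega(x)/x$ holds for infinitely many positive integers $x$; 5. $\mathrm{Bad}_\theta\cap\mathcal P$ is not $1/2$-winning in $\mathcal P$. Here $|\cdot|$ is the Euclidean norm. -/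

import Mathlib

namespace InhomWinning

noncomputable section

/-- A closed ball of positive radius in a metric space, recorded by its centre and radius. -/
structure GameBall (X : Type*) where
  center : X
  radius : ℝ
  radius_pos : 0 < radius

/-- The set of points of the closed ball. -/
def GameBall.toSet {X : Type*} [MetricSpace X] (b : GameBall X) : Set X :=
  Metric.closedBall b.center b.radius

/-- `IsMove ρ b c`: the ball `c` is a legal answer, with ratio `ρ`, to the ball `b`, that is,
`c ⊆ b` and the size of `c` is `ρ` times the size of `b`. In a Euclidean space of positive
dimension the diameter is twice the radius, so the ratio of radii is the ratio of diameters. -/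
def IsMove {X : Type*} [MetricSpace X] (ρ : ℝ) (b c : GameBall X) : Prop :=
  c.toSet ⊆ b.toSet ∧ c.radius = ρ * b.radius

/-- A strategy of player A: given the balls `[B₁, …, Bᵢ]` chosen so far by player B, it returns
the ball `Aᵢ`. -/
abbrev Strategy (X : Type*) := List (GameBall X) → GameBall X

/-- The balls `A₁, A₂, …` (indexed from `0`) which the strategy `σ` produces against the balls
`B₁, B₂, …` (indexed from `0`). -/
def Strategy.answer {X : Type*} (σ : Strategy X) (B : ℕ → GameBall X) (i : ℕ) : GameBall X :=
  σ ((List.range (i + 1)).map B)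

/-- `E` is `(α, β)`-winning for Schmidt's game on `X`: player A has a strategy such that, whenever
player B plays by the rules, all answers of A obey the rules and `⋂ Aᵢ` meets `E`. -/
def IsWinningPair {X : Type*} [MetricSpace X] (α β : ℝ) (E : Set X) : Prop :=
  ∃ σ : Strategy X, ∀ B : ℕ → GameBall X,
    (∀ i, IsMove β (σ.answer B i) (B (i + 1))) →
      (∀ i, IsMove α (B i) (σ.answer B i)) ∧ ((⋂ i, (σ.answer B i).toSet) ∩ E).Nonempty

/-- `E` is `α`-winning: it is `(α, β)`-winning for all `0 < β < 1`. -/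
def IsWinning {X : Type*} [MetricSpace X] (α : ℝ) (E : Set X) : Prop :=
  ∀ β : ℝ, 0 < β → β < 1 → IsWinningPair α β E

/-- `E ∩ 𝒜` is `α`-winning for Schmidt's game played in the affine subspace `𝒜`, with the metric
induced from `ℝⁿ`. -/
def IsWinningIn {n : ℕ} (α : ℝ) (E : Set (EuclideanSpace ℝ (Fin n)))
    (𝒜 : AffineSubspace ℝ (EuclideanSpace ℝ (Fin n))) : Prop :=
  IsWinning α {p : 𝒜 | (p : EuclideanSpace ℝ (Fin n)) ∈ E}

/-- `E ⊆ ℝⁿ` is isotropically winning: for each `1 ≤ d ≤ n` and each `d`-dimensional affine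
subspace `𝒜`, the set `E ∩ 𝒜` is `1/2`-winning in `𝒜`. (Single points, `d = 0`, are not
subspaces on which the game is played.) -/
def IsIsotropicallyWinning {n : ℕ} (E : Set (EuclideanSpace ℝ (Fin n))) : Prop :=
  ∀ d : ℕ, 1 ≤ d → d ≤ n → ∀ 𝒜 : AffineSubspace ℝ (EuclideanSpace ℝ (Fin n)),
    Module.finrank ℝ 𝒜.direction = d → IsWinningIn (1 / 2) E 𝒜

/-- The distance from a real number to the nearest integer. -/
def distInt (t : ℝ) : ℝ := |t - round t|

/-- `max_{i = 1, 2} ‖x θᵢ - ηᵢ‖`, with `‖·‖` the distance to the nearest integer. -/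
def approxError (θ η : EuclideanSpace ℝ (Fin 2)) (x : ℕ) : ℝ :=
  max (distInt ((x : ℝ) * θ 0 - η 0)) (distInt ((x : ℝ) * θ 1 - η 1))

/-- The set `Bad_θ`; the infimum is over the positive integers `x`. -/
def Bad (θ : EuclideanSpace ℝ (Fin 2)) : Set (EuclideanSpace ℝ (Fin 2)) :=
  {η | 0 < ⨅ x : ℕ+, ((x : ℕ) : ℝ) ^ (1 / 2 : ℝ) * approxError θ η (x : ℕ)}

end

end InhomWinning

open Filter Topology

namespace InhomWinning

/-! Baire category in the space of triples `(θ₁, θ₂, m)`, where `m` is the slope of the line through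
`θ`. Take `ψ` with `x ψ(x) → ∞`. Triples for which every point of the segment is `ψ`-approximated by
some `x ≥ N` form an open set (`isOpen_segmentApprox`). It is dense because it contains the rational
lines `θ₂ = m θ₁ + c` with `θ₁` irrational, where the problem becomes one-dimensional and has error
`O(1/x)` (`lineError_rational`). A generic triple works for all `N` and avoids the countably many
integer relations. Choosing `ψ` below both `ω(x)/x` and `x^(-3/4)` gives the fast approximation and
keeps the segment off `Bad θ`; a winning set meets every ball, so the game on the line is lost. -/

lemma distInt_eq_norm (t : ℝ) : distInt t = ‖(t : UnitAddCircle)‖ :=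
  UnitAddCircle.norm_eq.symm

lemma continuous_distInt : Continuous distInt := by
  have h : distInt = fun t : ℝ => ‖(t : UnitAddCircle)‖ := funext distInt_eq_norm
  rw [h]
  exact continuous_norm.comp (AddCircle.continuous_mk' 1)

lemma distInt_le (t : ℝ) (z : ℤ) : distInt t ≤ |t - z| := round_le t z

lemma approxError_nonneg (θ η : EuclideanSpace ℝ (Fin 2)) (x : ℕ) : 0 ≤ approxError θ η x :=
  le_max_of_le_left (abs_nonneg _)

/-- A one-dimensional inhomogeneous approximation theorem with positive multipliers. -/
lemma exists_inhomogeneous_approx {ξ : ℝ} (hξ : Irrational ξ) (t : ℝ) (N : ℕ) :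
    ∃ y : ℕ, N ≤ y ∧ 0 < y ∧ ∃ z : ℤ, |y * ξ - t - z| ≤ 5 / y := by
  have hinf := Real.infinite_rat_abs_sub_lt_one_div_den_sq_of_irrational hξ
  -- Each denominator admits only finitely many such `r`, so denominators are unbounded.
  obtain ⟨r, hr, hrN⟩ : ∃ r : ℚ, |ξ - r| < 1 / (r.den : ℝ) ^ 2 ∧ N < r.den := by
    by_contra! hcon
    refine hinf (Set.Finite.subset (s := ⋃ q ∈ Set.Iic N,
      {r : ℚ | |ξ - r| < 1 / (r.den : ℝ) ^ 2 ∧ r.den = q}) ?_ ?_)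
    · refine (Set.finite_Iic N).biUnion fun q _ => ?_
      rcases Nat.eq_zero_or_pos q with rfl | hq
      · convert Set.finite_empty
        ext r
        simp
      refine Set.Finite.of_finite_image (f := fun r : ℚ => r.num)
        ((Set.finite_Icc (⌊q * ξ⌋ - 1) (⌈q * ξ⌉ + 1)).subset ?_) ?_
      · rintro _ ⟨r, ⟨hr, rfl⟩, rfl⟩
        have hq' : (1 : ℝ) ≤ r.den := by exact_mod_cast hq
        have h1 : |r.den * ξ - r.num| ≤ 1 := by
          have : r.den * ξ - r.num = r.den * (ξ - r) := by
            rw [mul_sub]; congr 1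
            exact_mod_cast (Rat.den_mul_eq_num r).symm
          rw [this, abs_mul, abs_of_pos (by linarith : (0 : ℝ) < r.den)]
          have : (r.den : ℝ) * |ξ - r| ≤ r.den * (1 / (r.den : ℝ) ^ 2) := by gcongr
          refine this.trans ?_
          rw [mul_one_div, div_le_one (by positivity)]
          nlinarith
        have h2 := abs_le.1 h1
        constructor
        · have : ((⌊(r.den : ℝ) * ξ⌋ - 1 : ℤ) : ℝ) ≤ (r.num : ℤ) := by
            push_cast
            linarith [Int.floor_le ((r.den : ℝ) * ξ)]
          exact_mod_cast this
        · have : ((r.num : ℤ) : ℝ) ≤ ((⌈(r.den : ℝ) * ξ⌉ + 1 : ℤ) : ℝ) := by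
            push_cast
            linarith [Int.le_ceil ((r.den : ℝ) * ξ)]
          exact_mod_cast this
      · rintro a ⟨-, ha⟩ b ⟨-, hb⟩ hab
        exact Rat.ext hab (ha.trans hb.symm)
    · intro r hr
      simp only [Set.mem_iUnion]
      exact ⟨r.den, hcon r hr, hr, rfl⟩
  set q := r.den with hq
  have hq0 : 0 < q := r.den_pos
  have hqR : (0 : ℝ) < q := by exact_mod_cast hq0
  -- Bézout solves `y * r.num ≡ k` mod `q`, with `k / q` the nearest such fraction to `t`. Taking
  -- `y` in `[q, 2q)` makes it large, yet still comparable to `q`.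
  obtain ⟨u, v, huv⟩ : IsCoprime r.num (q : ℤ) := by
    rw [Int.isCoprime_iff_gcd_eq_one]
    exact r.reduced
  set k := round (q * t)
  set w := (u * k) % q
  have hw0 : 0 ≤ w := Int.emod_nonneg _ (by exact_mod_cast hq0.ne')
  have hwq : w < q := Int.emod_lt_of_pos _ (by exact_mod_cast hq0)
  have hw : w + q * ((u * k) / q) = u * k := Int.emod_add_mul_ediv _ _
  obtain ⟨y, hy⟩ : ∃ y : ℕ, (y : ℤ) = w + q := ⟨(w + q).toNat, by omega⟩
  have hqy : q ≤ y := by omega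
  have hyq : y ≤ 2 * q := by omega
  have hyR : (0 : ℝ) < y := by exact_mod_cast hq0.trans_le hqy
  refine ⟨y, hrN.le.trans hqy, hq0.trans_le hqy, -(k * v) + r.num * (1 - (u * k) / q), ?_⟩
  have hyr : (y : ℝ) * r.num
      = k + q * ((-(k * v) + r.num * (1 - (u * k) / q) : ℤ) : ℝ) := by
    have : (y : ℤ) * r.num = k + q * (-(k * v) + r.num * (1 - (u * k) / q)) := by
      rw [hy]
      linear_combination r.num * hw + k * huv
    exact_mod_cast this
  have hrr : (r : ℝ) * q = r.num := by exact_mod_cast Rat.mul_den_eq_num r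
  set z : ℤ := -(k * v) + r.num * (1 - (u * k) / q)
  have hsplit : (y * ξ - t - z) = y * (ξ - r) + (k - q * t) / q := by
    field_simp
    linear_combination hyr + (y : ℝ) * hrr
  have hk : |(k : ℝ) - q * t| ≤ 1 / 2 := by
    rw [abs_sub_comm]; exact abs_sub_round _
  have hyq' : (y : ℝ) ≤ 2 * q := by exact_mod_cast hyq
  calc |y * ξ - t - z| ≤ |(y : ℝ) * (ξ - r)| + |(k - q * t) / q| := by
        rw [hsplit]; exact abs_add_le _ _
    _ ≤ (2 * q) * (1 / (q : ℝ) ^ 2) + 1 / 2 / q := by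
        rw [abs_mul, abs_div, abs_of_pos hyR, abs_of_pos hqR]
        gcongr
    _ = 5 / (2 * q) := by field_simp; norm_num
    _ ≤ 5 / y := by gcongr

/-- The approximation error for the target `θ + s (1, m)`, where `p = (θ₁, θ₂, m)`. -/
noncomputable def lineError (p : ℝ × ℝ × ℝ) (s : ℝ) (x : ℕ) : ℝ :=
  max (distInt (x * p.1 - (p.1 + s))) (distInt (x * p.2.1 - (p.2.1 + s * p.2.2)))

lemma continuous_lineError (x : ℕ) :
    Continuous fun u : (ℝ × ℝ × ℝ) × ℝ => lineError u.1 u.2 x := by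
  unfold lineError
  exact (continuous_distInt.comp (by fun_prop)).max (continuous_distInt.comp (by fun_prop))

/-- The parameters whose whole unit segment is `ψ`-approximated by some multiplier `x ≥ N`. -/
def segmentApprox (ψ : ℕ → ℝ) (N : ℕ) : Set (ℝ × ℝ × ℝ) :=
  {p | ∀ s ∈ Set.Icc (-1 : ℝ) 1, ∃ x, N ≤ x ∧ lineError p s x < ψ x}

/-- Tube lemma: the condition is open in `(p, s)`, and `s` ranges over a compact interval. -/
lemma isOpen_segmentApprox (ψ : ℕ → ℝ) (N : ℕ) : IsOpen (segmentApprox ψ N) := by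
  have hW : IsOpen {u : (ℝ × ℝ × ℝ) × ℝ | ∃ x, N ≤ x ∧ lineError u.1 u.2 x < ψ x} := by
    have : {u : (ℝ × ℝ × ℝ) × ℝ | ∃ x, N ≤ x ∧ lineError u.1 u.2 x < ψ x}
        = ⋃ x, ⋃ _ : N ≤ x, {u | lineError u.1 u.2 x < ψ x} := by
      ext; simp
    rw [this]
    exact isOpen_iUnion fun x => isOpen_iUnion fun _ =>
      isOpen_lt (continuous_lineError x) continuous_const
  rw [isOpen_iff_eventually]
  intro p hp
  refine isCompact_Icc.eventually_forall_of_forall_eventually fun s hs => ?_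
  exact hW.eventually_mem (hp s hs)

/-- With `Q` a common denominator of `m` and `c`, the multiplier `x = 1 + Q y` cancels `θ`. Modulo
integers, the second error is then `m` times the first, so approximating `s / Q` by `y t` suffices.
-/
lemma lineError_rational {ψ : ℕ → ℝ} (hψ : Tendsto (fun x : ℕ => x * ψ x) atTop atTop) (N : ℕ)
    {t : ℝ} (ht : Irrational t) (c m : ℚ) :
    (t, m * t + c, (m : ℝ)) ∈ segmentApprox ψ N := by
  intro s _
  set Q : ℕ := m.den * c.den
  have hQ : 0 < Q := Nat.mul_pos m.den_pos c.den_pos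
  have hQR : (1 : ℝ) ≤ Q := by exact_mod_cast hQ
  have hmQ : (m : ℝ) * Q = ((m.num * c.den : ℤ) : ℝ) := by
    have h : (m : ℝ) * m.den = m.num := by exact_mod_cast Rat.mul_den_eq_num m
    push_cast [Q]
    rw [← mul_assoc, h]
  have hcQ : (c : ℝ) * Q = ((c.num * m.den : ℤ) : ℝ) := by
    have h : (c : ℝ) * c.den = c.num := by exact_mod_cast Rat.mul_den_eq_num c
    push_cast [Q]
    rw [← h]; ring
  set M : ℝ := max 1 |(m : ℝ)|
  have hM : 1 ≤ M := le_max_left _ _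
  -- The error is at most `M * Q * (5 / y)` and `x ≤ 2 * Q * y`; this threshold bounds their
  -- product.
  obtain ⟨N₁, hN₁⟩ := eventually_atTop.1 (hψ.eventually_gt_atTop (M * Q * 5 * (2 * Q)))
  obtain ⟨y, hyN, hy0, z, hz⟩ := exists_inhomogeneous_approx ht (s / Q) (max N N₁)
  have hyR : (1 : ℝ) ≤ y := by exact_mod_cast hy0
  have hyx : y ≤ 1 + Q * y := by nlinarith
  refine ⟨1 + Q * y, ((le_max_left _ _).trans hyN).trans hyx, ?_⟩
  have hbig := hN₁ (1 + Q * y) (((le_max_right _ _).trans hyN).trans hyx)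
  set δ : ℝ := y * t - s / Q - z
  have h1 : lineError (t, m * t + c, (m : ℝ)) s (1 + Q * y) ≤ M * (Q * |δ|) := by
    refine max_le ?_ ?_
    · refine (distInt_le _ (Q * z)).trans ?_
      have : ((1 + Q * y : ℕ) : ℝ) * t - (t + s) - ((Q * z : ℤ) : ℝ) = Q * δ := by
        push_cast [δ]; field_simp; ring
      simp only
      rw [this, abs_mul, Nat.abs_cast]
      exact le_mul_of_one_le_left (by positivity) hM
    · refine (distInt_le _ (m.num * c.den * z + c.num * m.den * y)).trans ?_
      have : ((1 + Q * y : ℕ) : ℝ) * (m * t + c) - (m * t + c + s * m)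
          - ((m.num * c.den * z + c.num * m.den * y : ℤ) : ℝ) = m * (Q * δ) := by
        have e : ((m.num * c.den * z + c.num * m.den * y : ℤ) : ℝ) = m * Q * z + c * Q * y := by
          rw [hmQ, hcQ]; push_cast; ring
        rw [e]
        push_cast [δ]; field_simp; ring
      simp only
      rw [this, abs_mul, abs_mul, Nat.abs_cast]
      gcongr
      exact le_max_right _ _
  refine h1.trans_lt ?_
  have hx0 : (0 : ℝ) < ((1 + Q * y : ℕ) : ℝ) := by positivity
  have hx2 : ((1 + Q * y : ℕ) : ℝ) ≤ 2 * Q * y := by push_cast; nlinarith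
  refine lt_of_mul_lt_mul_left (lt_of_le_of_lt ?_ hbig) hx0.le
  calc ((1 + Q * y : ℕ) : ℝ) * (M * (Q * |δ|)) ≤ (2 * Q * y) * (M * (Q * (5 / y))) := by gcongr
    _ = M * Q * 5 * (2 * Q) := by field_simp

lemma dense_segmentApprox {ψ : ℕ → ℝ} (hψ : Tendsto (fun x : ℕ => x * ψ x) atTop atTop) (N : ℕ) :
    Dense (segmentApprox ψ N) := by
  have hQ : Dense (Set.range ((↑) : ℚ → ℝ)) := Rat.denseRange_cast
  have hd : Dense ({t : ℝ | Irrational t} ×ˢ (Set.range ((↑) : ℚ → ℝ) ×ˢ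
      Set.range ((↑) : ℚ → ℝ))) := dense_irrational.prod (hQ.prod hQ)
  -- A continuous surjection carries the dense set of admissible `(t, c, m)` to a dense set of
  -- triples.
  let g : ℝ × ℝ × ℝ → ℝ × ℝ × ℝ := fun u => (u.1, u.2.2 * u.1 + u.2.1, u.2.2)
  have hg : Function.Surjective g := fun v => ⟨(v.1, v.2.1 - v.2.2 * v.1, v.2.2), by simp [g]⟩
  refine (hg.denseRange.dense_image (by fun_prop) hd).mono ?_
  rintro _ ⟨⟨t, c, m⟩, ⟨ht, ⟨c, rfl⟩, ⟨m, rfl⟩⟩, rfl⟩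
  exact lineError_rational hψ N ht c m

lemma isOpen_affine_ne_zero (a b c : ℝ) :
    IsOpen {p : ℝ × ℝ × ℝ | a + b * p.1 + c * p.2.1 ≠ 0} :=
  isOpen_ne_fun (by fun_prop) continuous_const

lemma dense_affine_ne_zero {a b c : ℝ} (h : ¬ (a = 0 ∧ b = 0 ∧ c = 0)) :
    Dense {p : ℝ × ℝ × ℝ | a + b * p.1 + c * p.2.1 ≠ 0} := by
  by_cases hbc : b = 0 ∧ c = 0
  · obtain ⟨rfl, rfl⟩ := hbc
    have ha : a ≠ 0 := by simpa using h
    simp [ha]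
  have hpos : b ^ 2 + c ^ 2 ≠ 0 := fun h0 =>
    hbc ⟨by nlinarith [sq_nonneg b, sq_nonneg c], by nlinarith [sq_nonneg b, sq_nonneg c]⟩
  let f : ℝ × ℝ × ℝ →L[ℝ] ℝ := b • ContinuousLinearMap.fst ℝ ℝ (ℝ × ℝ) +
    c • (ContinuousLinearMap.fst ℝ ℝ ℝ).comp (ContinuousLinearMap.snd ℝ ℝ (ℝ × ℝ))
  have hf : ∀ p, f p = b * p.1 + c * p.2.1 := fun p => by simp [f]
  have hsurj : Function.Surjective f := fun r =>
    ⟨(r / (b ^ 2 + c ^ 2) * b, r / (b ^ 2 + c ^ 2) * c, 0), by rw [hf]; field_simp⟩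
  have := (dense_compl_singleton (-a)).preimage (f.isOpenMap hsurj)
  refine this.mono fun p hp => ?_
  simp only [Set.mem_preimage, Set.mem_compl_iff, Set.mem_singleton_iff, hf] at hp
  intro h0
  exact hp (by linear_combination h0)

lemma exists_generic_line {ψ : ℕ → ℝ} (hψ : Tendsto (fun x : ℕ => x * ψ x) atTop atTop) :
    ∃ p : ℝ × ℝ × ℝ, LinearIndependent ℤ ![(1 : ℝ), p.1, p.2.1] ∧
      ∀ N, p ∈ segmentApprox ψ N := by
  have h1 : ∀ᶠ p in residual (ℝ × ℝ × ℝ), ∀ N, p ∈ segmentApprox ψ N :=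
    eventually_countable_forall.2 fun N =>
      residual_of_dense_open (isOpen_segmentApprox ψ N) (dense_segmentApprox hψ N)
  have h2 : ∀ᶠ p : ℝ × ℝ × ℝ in residual (ℝ × ℝ × ℝ),
      ∀ k : {k : ℤ × ℤ × ℤ // ¬ (k.1 = 0 ∧ k.2.1 = 0 ∧ k.2.2 = 0)},
        (k.1.1 : ℝ) + k.1.2.1 * p.1 + k.1.2.2 * p.2.1 ≠ 0 :=
    eventually_countable_forall.2 fun k =>
      residual_of_dense_open (isOpen_affine_ne_zero _ _ _)
        (dense_affine_ne_zero (by exact_mod_cast k.2))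
  obtain ⟨p, hp1, hp2⟩ := (dense_of_mem_residual (h1.and h2)).nonempty
  refine ⟨p, ?_, hp1⟩
  rw [Fintype.linearIndependent_iff]
  intro g hg
  by_contra hne
  refine hp2 ⟨(g 0, g 1, g 2), ?_⟩ ?_
  · rintro ⟨h0, h1, h2⟩
    exact hne fun i => by fin_cases i <;> assumption
  · simpa [Fin.sum_univ_three] using hg

lemma notMem_Bad_of_frequently {θ η : EuclideanSpace ℝ (Fin 2)}
    (h : ∀ N : ℕ, ∃ x, N ≤ x ∧ approxError θ η x < (x : ℝ) ^ (-(3 / 4) : ℝ)) : η ∉ Bad θ := by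
  intro hη
  set ε := ⨅ x : ℕ+, ((x : ℕ) : ℝ) ^ (1 / 2 : ℝ) * approxError θ η (x : ℕ) with hε
  have hε0 : 0 < ε := hη
  -- `1/2 - 3/4 = -1/4`, so the scaled error tends to zero along these `x`.
  have hlim : Tendsto (fun x : ℕ => (x : ℝ) ^ (-(1 / 4) : ℝ)) atTop (𝓝 0) :=
    (tendsto_rpow_neg_atTop (by norm_num)).comp tendsto_natCast_atTop_atTop
  obtain ⟨N, hN⟩ := eventually_atTop.1 (hlim.eventually_lt_const hε0)
  obtain ⟨x, hx, herr⟩ := h (max N 1)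
  have hx1 : 0 < x := (le_max_right N 1).trans hx
  have hxR : (0 : ℝ) < x := by exact_mod_cast hx1
  have hle : ε ≤ (x : ℝ) ^ (1 / 2 : ℝ) * approxError θ η x := by
    refine ciInf_le (f := fun x : ℕ+ => ((x : ℕ) : ℝ) ^ (1 / 2 : ℝ) * approxError θ η (x : ℕ))
      ⟨0, ?_⟩ ⟨x, hx1⟩
    rintro _ ⟨y, rfl⟩
    exact mul_nonneg (by positivity) (approxError_nonneg _ _ _)
  have hlt : (x : ℝ) ^ (1 / 2 : ℝ) * approxError θ η x < (x : ℝ) ^ (-(1 / 4) : ℝ) := by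
    calc _ < (x : ℝ) ^ (1 / 2 : ℝ) * (x : ℝ) ^ (-(3 / 4) : ℝ) := by gcongr
      _ = _ := by rw [← Real.rpow_add hxR]; norm_num
  exact absurd (hN x ((le_max_left _ _).trans hx)) (hle.trans hlt.le).not_gt

/-- The history of the play in which B starts with `b` and then always answers concentrically
with ratio `β`. -/
def concentricHistory {X : Type*} (σ : Strategy X) (b : GameBall X) {β : ℝ} (hβ : 0 < β) :
    ℕ → List (GameBall X)
  | 0 => [b]
  | n + 1 => concentricHistory σ b hβ n ++
      [⟨(σ (concentricHistory σ b hβ n)).center, β * (σ (concentricHistory σ b hβ n)).radius,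
        mul_pos hβ (σ (concentricHistory σ b hβ n)).radius_pos⟩]

/-- A winning set meets every closed ball. -/
lemma IsWinningPair.inter_closedBall_nonempty {X : Type*} [MetricSpace X] {α β : ℝ} {E : Set X}
    (hE : IsWinningPair α β E) (hβ : 0 < β) (hβ1 : β ≤ 1) (b : GameBall X) :
    (b.toSet ∩ E).Nonempty := by
  obtain ⟨σ, hσ⟩ := hE
  let reply : GameBall X → GameBall X := fun a => ⟨a.center, β * a.radius, mul_pos hβ a.radius_pos⟩
  let B : ℕ → GameBall X := fun n => match n with
    | 0 => b
    | n + 1 => reply (σ (concentricHistory σ b hβ n))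
  have hB : ∀ n, (List.range (n + 1)).map B = concentricHistory σ b hβ n := by
    intro n
    induction n with
    | zero => rfl
    | succ n ih => rw [List.range_succ, List.map_append, ih]; rfl
  have hans : ∀ n, σ.answer B n = σ (concentricHistory σ b hβ n) := fun n => by
    rw [Strategy.answer, hB]
  obtain ⟨hA, y, hy, hyE⟩ := hσ B fun i => by
    rw [hans]
    refine ⟨Metric.closedBall_subset_closedBall ?_, rfl⟩
    exact mul_le_of_le_one_left (GameBall.radius_pos _).le hβ1
  exact ⟨y, (hA 0).1 (Set.mem_iInter.1 hy 0), hyE⟩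

end InhomWinning

open InhomWinning in
theorem theorem3p1 (ω : ℝ → ℝ) (hω_pos : ∀ t : ℝ, 0 < t → 0 < ω t)
    (hω_mono : MonotoneOn ω (Set.Ioi 0)) (hω_lim : Filter.Tendsto ω Filter.atTop Filter.atTop) :
    ∃ (θ : EuclideanSpace ℝ (Fin 2)) (P : AffineSubspace ℝ (EuclideanSpace ℝ (Fin 2))),
      LinearIndependent ℤ ![(1 : ℝ), θ 0, θ 1] ∧
      ¬ InhomWinning.IsIsotropicallyWinning (InhomWinning.Bad θ) ∧
      Module.finrank ℝ P.direction = 1 ∧ θ ∈ P ∧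
      ((P : Set (EuclideanSpace ℝ (Fin 2))) ∩ Metric.closedBall θ 1) ∩ InhomWinning.Bad θ = ∅ ∧
      (∀ η ∈ (P : Set (EuclideanSpace ℝ (Fin 2))) ∩ Metric.closedBall θ 1,
        {x : ℕ | 0 < x ∧ InhomWinning.approxError θ η x < ω (x : ℝ) / (x : ℝ)}.Infinite) ∧
      ¬ InhomWinning.IsWinningIn (1 / 2) (InhomWinning.Bad θ) P := by
  let ψ : ℕ → ℝ := fun x => min (ω x / x) ((x : ℝ) ^ (-(3 / 4) : ℝ))
  have hψ : Tendsto (fun x : ℕ => x * ψ x) atTop atTop := by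
    have h1 : Tendsto (fun x : ℕ => ω x) atTop atTop := hω_lim.comp tendsto_natCast_atTop_atTop
    have h2 : Tendsto (fun x : ℕ => (x : ℝ) ^ (1 / 4 : ℝ)) atTop atTop :=
      (tendsto_rpow_atTop (by norm_num)).comp tendsto_natCast_atTop_atTop
    have h3 : Tendsto (fun x : ℕ => min (ω x) ((x : ℝ) ^ (1 / 4 : ℝ))) atTop atTop :=
      tendsto_atTop.2 fun b => by
        filter_upwards [tendsto_atTop.1 h1 b, tendsto_atTop.1 h2 b] with x hx hx'
        exact le_min hx hx'
    refine h3.congr' ?_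
    filter_upwards [eventually_gt_atTop 0] with x hx
    have hxR : (0 : ℝ) < x := by exact_mod_cast hx
    have e : (x : ℝ) * (x : ℝ) ^ (-(3 / 4) : ℝ) = (x : ℝ) ^ (1 / 4 : ℝ) := by
      nth_rewrite 1 [← Real.rpow_one (x : ℝ)]
      rw [← Real.rpow_add hxR]; norm_num
    simp only [ψ]
    rw [mul_min_of_nonneg _ _ hxR.le, e, mul_div_cancel₀ _ hxR.ne']
  obtain ⟨⟨t₁, t₂, m⟩, hli, hseg⟩ := exists_generic_line hψ
  let θ : EuclideanSpace ℝ (Fin 2) := !₂[t₁, t₂]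
  let v : EuclideanSpace ℝ (Fin 2) := !₂[1, m]
  have hv : v ≠ 0 := fun h => by simpa [v] using congrArg (fun w => w 0) h
  let P : AffineSubspace ℝ (EuclideanSpace ℝ (Fin 2)) := AffineSubspace.mk' θ (ℝ ∙ v)
  have hθP : θ ∈ P := AffineSubspace.self_mem_mk' _ _
  have hfin : Module.finrank ℝ P.direction = 1 := by
    rw [AffineSubspace.direction_mk']
    exact finrank_span_singleton hv
  have happrox : ∀ η ∈ (P : Set (EuclideanSpace ℝ (Fin 2))) ∩ Metric.closedBall θ 1,
      ∀ N, ∃ x, N ≤ x ∧ approxError θ η x < ψ x := by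
    rintro η ⟨hηP, hηb⟩ N
    obtain ⟨s, hs⟩ := Submodule.mem_span_singleton.1 (AffineSubspace.mem_mk'.1 hηP)
    have hηs : η = θ + s • v := by
      rw [hs, vsub_eq_sub]; abel
    -- `v` has first coordinate `1`, so `s` is the first coordinate of `η - θ`.
    have hs1 : |s| ≤ 1 := by
      have h1 : ‖(η - θ) 0‖ ≤ ‖η - θ‖ := PiLp.norm_apply_le _ _
      rw [mem_closedBall_iff_norm] at hηb
      have h2 : (η - θ) 0 = s := by simp [hηs, v]
      rw [h2] at h1
      exact h1.trans hηb
    obtain ⟨x, hx, herr⟩ := hseg N s (abs_le.1 hs1)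
    refine ⟨x, hx, ?_⟩
    have : approxError θ η x = lineError (t₁, t₂, m) s x := by
      simp [approxError, lineError, hηs, θ, v]
    rwa [this]
  have hdisj : ∀ η ∈ (P : Set (EuclideanSpace ℝ (Fin 2))) ∩ Metric.closedBall θ 1,
      η ∉ Bad θ := fun η hη => notMem_Bad_of_frequently fun N =>
    (happrox η hη N).imp fun x hx => ⟨hx.1, hx.2.trans_le (min_le_right _ _)⟩
  have hlose : ¬ IsWinningIn (1 / 2) (Bad θ) P := fun hwin => by
    obtain ⟨y, hy, hyE⟩ := (hwin (1 / 2) (by norm_num) (by norm_num)).inter_closedBall_nonempty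
      (by norm_num) (by norm_num) ⟨⟨θ, hθP⟩, 1, one_pos⟩
    exact hdisj y ⟨y.2, hy⟩ hyE
  refine ⟨θ, P, hli, fun h => hlose (h 1 le_rfl one_le_two P hfin), hfin, hθP, ?_, ?_, hlose⟩
  · exact Set.eq_empty_of_forall_notMem fun η hη => hdisj η hη.1 hη.2
  · intro η hη
    refine Set.infinite_of_not_bddAbove fun ⟨N, hN⟩ => ?_
    obtain ⟨x, hx, herr⟩ := happrox η hη (N + 1)
    have := hN ⟨by omega, herr.trans_le (min_le_left _ _)⟩
    omega
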